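/- Let $\mathbb{D}=\{z\in\mathbb{C}:|z|<1\}$ and let $\partial=\frac12\left(\frac{\partial}{\partial x}-i\frac{\partial}{\partial y}\right)$ and $\overline{\partial}=\frac12\left(\frac{\partial}{\partial x}+i\frac{\partial}{\partial y}\right)$ be the Wirtinger derivatives, where $z=x+iy$. If $(\alpha,\beta)\in\mathbb{C}^2$ satisfies $$\left(\frac{|\alpha|^4+4|\alpha\beta|^2+|\beta|^4}{6}\right)^{1/4}\le\frac{2}{\pi},$$ then there is a (complex-valued) harmonic function $f\colon\mathbb{D}\to\mathbb{D}$ with $f(0)=0$, $\partial f(0)=\alpha$ and $\overline{\partial}f(0)=\beta$. The constant $2/\pi$ is sharp: for every real $C>2/\pi$ there is $(\alpha,\beta)\in\mathbb{C}^2$ with $\left(\frac{|\alpha|^4+4|\alpha\beta|^2+|\beta|^4}{6}\right)^{1/4}\le C$ for which no harmonic $f\colon\mathbb{D}\to\mathbb{D}$ satisfies $f(0)=0$, $\partial f(0)=\alpha$ and $\overline{\partial}f(0)=\beta$. -/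

import Mathlib

open Metric InnerProductSpace

/-- The Wirtinger derivative `∂f = (1/2)(∂f/∂x - i ∂f/∂y)` at the point `z`, where the partial
derivatives are the real Fréchet derivative evaluated in the directions `1` and `i`. -/
noncomputable def wirtinger (f : ℂ → ℂ) (z : ℂ) : ℂ :=
  (1 / 2 : ℂ) * (fderiv ℝ f z 1 - Complex.I * fderiv ℝ f z Complex.I)

/-- The conjugate Wirtinger derivative `(1/2)(∂f/∂x + i ∂f/∂y)` at the point `z`. -/
noncomputable def wirtingerBar (f : ℂ → ℂ) (z : ℂ) : ℂ :=
  (1 / 2 : ℂ) * (fderiv ℝ f z 1 + Complex.I * fderiv ℝ f z Complex.I)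

/-!
On the unit circle take the boundary values `(cos θ + i k sin θ) / |cos θ + i k sin θ|` with
`-1 ≤ k ≤ 1`. They are odd, so their Poisson extension fixes the origin; its Wirtinger derivatives
there are `(P ± Q) / 2`, where `P` and `Q` are Fourier coefficients depending on `k`. Rotations and
contractions reduce the existence part to showing that the curve of these derivatives lies outside
the quartic ball, i.e. that a quartic form `N (P, Q)` is at least its value at `k = 0`, where
`(P, Q) = (4 / π, 0)`.

One has `P' = -k Q'` with `Q' ≥ 0`, so `N (P, Q)` increases on `[0, 1]` as soon as
`k ≤ ∂_q N / ∂_p N` at `(P, Q)`. The right-hand side depends on `r = Q / P` only, and `r` solves the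
Riccati equation `r' = r / k - (1 - r²) / (1 - k²)`. Equality holds at `k = 1`, and the Riccati
equation shows that the difference of the two sides cannot become negative to the left of it.

For sharpness take `α = β = C`: the Poisson formula gives `‖Df(0)‖ ≤ 4 / π` for harmonic self-maps
of the disk, while `Df(0) 1 = α + β = 2 C`.
-/

open MeasureTheory Set Filter Topology
open scoped Real Interval ComplexConjugate

section Wirtinger

lemma fderiv_apply_eq_wirtinger (f : ℂ → ℂ) (z h : ℂ) :
    fderiv ℝ f z h = wirtinger f z * h + wirtingerBar f z * conj h := by
  have hh : h = h.re • (1 : ℂ) + h.im • Complex.I := by simp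
  have hL : fderiv ℝ f z h = h.re • fderiv ℝ f z 1 + h.im • fderiv ℝ f z Complex.I := by
    rw [← map_smul, ← map_smul, ← map_add, ← hh]
  rw [hL, wirtinger, wirtingerBar, Complex.real_smul, Complex.real_smul,
    Complex.re_eq_add_conj, Complex.im_eq_sub_conj]
  field_simp
  linear_combination fderiv ℝ f z Complex.I * (h - conj h) * Complex.I_sq

lemma hasFDerivAt_add_conj {h₁ h₂ : ℂ → ℂ} {a b z : ℂ} (d₁ : HasDerivAt h₁ a z)
    (d₂ : HasDerivAt h₂ b z) :
    HasFDerivAt (fun w ↦ h₁ w + conj (h₂ w))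
      ((ContinuousLinearMap.toSpanSingleton ℂ a).restrictScalars ℝ +
        (Complex.conjCLE : ℂ →L[ℝ] ℂ).comp
          ((ContinuousLinearMap.toSpanSingleton ℂ b).restrictScalars ℝ)) z :=
  (d₁.hasFDerivAt.restrictScalars ℝ).add
    ((Complex.conjCLE : ℂ →L[ℝ] ℂ).hasFDerivAt.comp z (d₂.hasFDerivAt.restrictScalars ℝ))

lemma wirtinger_add_conj {h₁ h₂ : ℂ → ℂ} {a b z : ℂ} (d₁ : HasDerivAt h₁ a z)
    (d₂ : HasDerivAt h₂ b z) : wirtinger (fun w ↦ h₁ w + conj (h₂ w)) z = a := by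
  rw [wirtinger, (hasFDerivAt_add_conj d₁ d₂).fderiv]
  simp only [add_apply, ContinuousLinearMap.coe_restrictScalars',
    ContinuousLinearMap.toSpanSingleton_apply, smul_eq_mul, one_mul,
    ContinuousLinearMap.comp_apply, ContinuousLinearEquiv.coe_coe,
    ContinuousAlgEquiv.coeCLE_apply, Complex.conjCAE_apply, map_mul, Complex.conj_I, neg_mul]
  linear_combination (-a / 2 + conj b / 2) * Complex.I_mul_I

lemma wirtingerBar_add_conj {h₁ h₂ : ℂ → ℂ} {a b z : ℂ} (d₁ : HasDerivAt h₁ a z)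
    (d₂ : HasDerivAt h₂ b z) : wirtingerBar (fun w ↦ h₁ w + conj (h₂ w)) z = conj b := by
  rw [wirtingerBar, (hasFDerivAt_add_conj d₁ d₂).fderiv]
  simp only [add_apply, ContinuousLinearMap.coe_restrictScalars',
    ContinuousLinearMap.toSpanSingleton_apply, smul_eq_mul, one_mul,
    ContinuousLinearMap.comp_apply, ContinuousLinearEquiv.coe_coe,
    ContinuousAlgEquiv.coeCLE_apply, Complex.conjCAE_apply, map_mul, Complex.conj_I, neg_mul]
  linear_combination (a / 2 - conj b / 2) * Complex.I_mul_I

lemma harmonicOnNhd_add_conj {h₁ h₂ : ℂ → ℂ} {s : Set ℂ} (a₁ : AnalyticOnNhd ℂ h₁ s)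
    (a₂ : AnalyticOnNhd ℂ h₂ s) : HarmonicOnNhd (fun w ↦ h₁ w + conj (h₂ w)) s :=
  fun z hz ↦ (a₁ z hz).harmonicAt.add (a₂ z hz).harmonicAt_conj

lemma wirtinger_congr {f g : ℂ → ℂ} {z : ℂ} (h : f =ᶠ[𝓝 z] g) :
    wirtinger f z = wirtinger g z := by
  rw [wirtinger, wirtinger, h.fderiv_eq]

lemma wirtingerBar_congr {f g : ℂ → ℂ} {z : ℂ} (h : f =ᶠ[𝓝 z] g) :
    wirtingerBar f z = wirtingerBar g z := by
  rw [wirtingerBar, wirtingerBar, h.fderiv_eq]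

end Wirtinger

section CircleAverage

variable {g : ℂ → ℂ} {R : ℝ}

lemma circleIntegrable_conj (hg : CircleIntegrable g 0 R) :
    CircleIntegrable (fun ζ ↦ conj (g ζ)) 0 R :=
  ⟨(Complex.conjCLE : ℂ →L[ℝ] ℂ).integrable_comp hg.1,
    (Complex.conjCLE : ℂ →L[ℝ] ℂ).integrable_comp hg.2⟩

lemma conj_circleAverage (hg : CircleIntegrable g 0 R) :
    conj (Real.circleAverage g 0 R) = Real.circleAverage (fun ζ ↦ conj (g ζ)) 0 R :=
  ((Complex.conjCLE : ℂ →L[ℝ] ℂ).circleAverage_comp_comm hg).symm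

lemma norm_circleAverage_le_circleAverage {E : Type*} [NormedAddCommGroup E] [NormedSpace ℝ E]
    {f : ℂ → E} {b : ℂ → ℝ} {c : ℂ} {R : ℝ} (hb : CircleIntegrable b c R)
    (h : ∀ z ∈ sphere c |R|, ‖f z‖ ≤ b z) :
    ‖Real.circleAverage f c R‖ ≤ Real.circleAverage b c R := by
  rw [Real.circleAverage, Real.circleAverage, norm_smul, Real.norm_of_nonneg (by positivity),
    smul_eq_mul]
  gcongr
  exact intervalIntegral.norm_integral_le_of_norm_le (by positivity)
    (Eventually.of_forall fun θ _ ↦ h _ (circleMap_mem_sphere' c R θ)) hb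

lemma circleAverage_comp_mul_left {E : Type*} [NormedAddCommGroup E] [NormedSpace ℝ E]
    (f : ℂ → E) {u : ℂ} (hu : ‖u‖ = 1) (R : ℝ) :
    Real.circleAverage (fun ζ ↦ f (u * ζ)) 0 R = Real.circleAverage f 0 R := by
  rw [Real.circleAverage_eq_integral_add (f := f) u.arg, Real.circleAverage]
  congr 2 with θ
  have hexp : Complex.exp (u.arg * Complex.I) = u := by
    simpa [hu] using Complex.norm_mul_exp_arg_mul_I u
  rw [circleMap_zero, circleMap_zero, Complex.ofReal_add, add_mul, Complex.exp_add, hexp]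
  ring_nf

lemma circleAverage_eq_zero_of_odd {E : Type*} [NormedAddCommGroup E] [NormedSpace ℝ E]
    {f : ℂ → E} (hf : ∀ z, f (-z) = -f z) (R : ℝ) : Real.circleAverage f 0 R = 0 := by
  have h := circleAverage_comp_mul_left f (u := -1) (by simp) R
  have hneg : (fun z ↦ f (-1 * z)) = (-1 : ℝ) • f := by
    ext z
    simp [hf]
  rw [hneg, Real.circleAverage_smul, neg_one_smul] at h
  have : IsAddTorsionFree E := .of_isTorsionFree ℝ E
  exact self_eq_neg.1 h.symm

end CircleAverage

section Poisson

/-- The Poisson integral of boundary values `g` on the circle `|ζ| = R`, as a function on the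
disk `|w| < R`. -/
noncomputable def poissonIntegral (g : ℂ → ℂ) (R : ℝ) (w : ℂ) : ℂ :=
  Real.circleAverage (poissonKernel 0 w • g) 0 R

/-- Half the Herglotz–Riesz integral of `g`: the holomorphic part of `poissonIntegral g R`. -/
noncomputable def herglotzIntegral (g : ℂ → ℂ) (R : ℝ) (w : ℂ) : ℂ :=
  (1 / 2 : ℂ) * Real.circleAverage (fun ζ ↦ herglotzRieszKernel 0 w ζ • g ζ) 0 R

variable {g : ℂ → ℂ} {R : ℝ} {w : ℂ}

lemma analyticOnNhd_herglotzIntegral (hg : CircleIntegrable g 0 R) :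
    AnalyticOnNhd ℂ (herglotzIntegral g R) (ball 0 R) :=
  analyticOnNhd_const.mul (analyticOnNhd_circleAverage_herglotzRieszKernel_smul hg)

lemma hasDerivAt_herglotzIntegral_zero (hg : CircleIntegrable g 0 R) (hR : 0 < R) :
    HasDerivAt (herglotzIntegral g R) (Real.circleAverage (fun ζ ↦ g ζ / ζ) 0 R) 0 := by
  refine ((hasDerivAt_circleAverage_herglotzRieszKernel_smul hg (mem_ball_self hR)).const_mul
    (1 / 2 : ℂ)).congr_deriv ?_
  rw [← smul_eq_mul, ← Real.circleAverage_fun_smul]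
  refine Real.circleAverage_congr_sphere fun ζ hζ ↦ ?_
  have : ζ ≠ 0 := ne_zero_of_mem_sphere (abs_pos.2 hR.ne').ne' ⟨ζ, hζ⟩
  simp only [smul_eq_mul, sub_zero]
  field_simp

lemma continuousOn_poissonKernel_sphere (hw : w ∈ ball 0 R) :
    ContinuousOn (poissonKernel 0 w) (sphere 0 |R|) := by
  rw [poissonKernel_eq_re_herglotzRieszKernel]
  exact Complex.continuous_re.comp_continuousOn (continuousOn_herglotzRieszKernel_sphere hw)

lemma poissonIntegral_eq_add_conj (hg : CircleIntegrable g 0 R) (hw : w ∈ ball 0 R) :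
    poissonIntegral g R w =
      herglotzIntegral g R w + conj (herglotzIntegral (fun ζ ↦ conj (g ζ)) R w) := by
  have hK := continuousOn_herglotzRieszKernel_sphere hw
  have h₁ : CircleIntegrable (fun ζ ↦ herglotzRieszKernel 0 w ζ * g ζ) 0 R :=
    hg.continuousOn_mul hK
  have h₂ : CircleIntegrable (fun ζ ↦ herglotzRieszKernel 0 w ζ * conj (g ζ)) 0 R :=
    (circleIntegrable_conj hg).continuousOn_mul hK
  simp only [poissonIntegral, herglotzIntegral, smul_eq_mul, map_mul, conj_circleAverage h₂]
  rw [show conj (1 / 2 : ℂ) = 1 / 2 by simp [map_ofNat], ← mul_add,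
    ← Real.circleAverage_fun_add h₁ (by simpa using circleIntegrable_conj h₂), ← smul_eq_mul,
    ← Real.circleAverage_fun_smul]
  congr 1 with ζ
  simp only [poissonKernel_eq_re_herglotzRieszKernel, Pi.smul_apply', Function.comp_apply,
    Complex.real_smul, Complex.re_eq_add_conj, Complex.conj_conj, smul_eq_mul]
  ring

lemma harmonicOnNhd_poissonIntegral (hg : CircleIntegrable g 0 R) :
    HarmonicOnNhd (poissonIntegral g R) (ball 0 R) := by
  have h := harmonicOnNhd_add_conj (analyticOnNhd_herglotzIntegral hg)
    (analyticOnNhd_herglotzIntegral (circleIntegrable_conj hg))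
  intro w hw
  refine (harmonicAt_congr_nhds ?_).2 (h w hw)
  filter_upwards [isOpen_ball.mem_nhds hw] with z hz using poissonIntegral_eq_add_conj hg hz

lemma poissonIntegral_eventuallyEq_add_conj (hg : CircleIntegrable g 0 R) (hR : 0 < R) :
    poissonIntegral g R =ᶠ[𝓝 0] fun w ↦
      herglotzIntegral g R w + conj (herglotzIntegral (fun ζ ↦ conj (g ζ)) R w) := by
  filter_upwards [ball_mem_nhds 0 hR] with w hw using poissonIntegral_eq_add_conj hg hw

lemma wirtinger_poissonIntegral_zero (hg : CircleIntegrable g 0 R) (hR : 0 < R) :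
    wirtinger (poissonIntegral g R) 0 = Real.circleAverage (fun ζ ↦ g ζ / ζ) 0 R := by
  rw [wirtinger_congr (poissonIntegral_eventuallyEq_add_conj hg hR),
    wirtinger_add_conj (hasDerivAt_herglotzIntegral_zero hg hR)
      (hasDerivAt_herglotzIntegral_zero (circleIntegrable_conj hg) hR)]

lemma circleIntegrable_div_self (hg : CircleIntegrable g 0 R) (hR : R ≠ 0) :
    CircleIntegrable (fun ζ ↦ g ζ / ζ) 0 R := by
  simp only [div_eq_mul_inv]
  exact hg.mul_continuousOn <| continuousOn_inv₀.mono fun ζ hζ ↦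
    ne_zero_of_mem_sphere (abs_pos.2 hR).ne' ⟨ζ, hζ⟩

lemma wirtingerBar_poissonIntegral_zero (hg : CircleIntegrable g 0 R) (hR : 0 < R) :
    wirtingerBar (poissonIntegral g R) 0 = Real.circleAverage (fun ζ ↦ g ζ / conj ζ) 0 R := by
  have hgc := circleIntegrable_conj hg
  rw [wirtingerBar_congr (poissonIntegral_eventuallyEq_add_conj hg hR),
    wirtingerBar_add_conj (hasDerivAt_herglotzIntegral_zero hg hR)
      (hasDerivAt_herglotzIntegral_zero hgc hR),
    conj_circleAverage (circleIntegrable_div_self hgc hR.ne')]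
  simp only [map_div₀, Complex.conj_conj]

lemma circleAverage_poissonKernel (hw : w ∈ ball 0 R) :
    Real.circleAverage (poissonKernel 0 w) 0 R = 1 := by
  have h := (harmonicOnNhd_const (1 : ℝ)).circleAverage_poissonKernel_smul hw
  rwa [show poissonKernel 0 w • (fun _ : ℂ ↦ (1 : ℝ)) = poissonKernel 0 w by ext; simp] at h

/- Since `g` has mean zero, the minimum `(R - ‖w‖) / (R + ‖w‖)` of the Poisson kernel may be
subtracted from it, which leaves a nonnegative kernel of total mass `2 * ‖w‖ / (R + ‖w‖)`. -/
lemma norm_poissonIntegral_le {M : ℝ} (hg : CircleIntegrable g 0 R)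
    (hM : ∀ ζ ∈ sphere 0 |R|, ‖g ζ‖ ≤ M) (h0 : Real.circleAverage g 0 R = 0)
    (hw : w ∈ ball 0 R) : ‖poissonIntegral g R w‖ ≤ M * (2 * ‖w‖ / (R + ‖w‖)) := by
  have hR : 0 < R := pos_of_mem_ball hw
  set m : ℝ := (R - ‖w‖) / (R + ‖w‖) with hm
  have hK := continuousOn_poissonKernel_sphere hw
  have hKi : CircleIntegrable (fun ζ ↦ poissonKernel 0 w ζ - m) 0 R :=
    (hK.sub continuousOn_const).circleIntegrable'
  have hsub : poissonIntegral g R w =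
      Real.circleAverage (fun ζ ↦ (poissonKernel 0 w ζ - m) • g ζ) 0 R := by
    simp only [sub_smul]
    rw [Real.circleAverage_fun_sub (f₁ := fun ζ ↦ poissonKernel 0 w ζ • g ζ)
        (f₂ := fun ζ ↦ m • g ζ) (hg.continuousOn_smul hK)
        (hg.fun_continuousOn_smul continuousOn_const),
      Real.circleAverage_fun_smul, h0, smul_zero, sub_zero, poissonIntegral, Pi.smul_def']
  have hle : ∀ ζ ∈ sphere 0 |R|, m ≤ poissonKernel 0 w ζ := fun ζ hζ ↦ by
    rw [abs_of_pos hR] at hζ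
    simpa [poissonKernel_eq_re_herglotzRieszKernel, herglotzRieszKernel_def]
      using le_re_herglotzRieszKernel hζ hw
  calc ‖poissonIntegral g R w‖
      ≤ Real.circleAverage (fun ζ ↦ M • (poissonKernel 0 w ζ - m)) 0 R := by
        rw [hsub]
        refine norm_circleAverage_le_circleAverage hKi.const_smul fun ζ hζ ↦ ?_
        have hpos := sub_nonneg.2 (hle ζ hζ)
        rw [norm_smul, Real.norm_of_nonneg hpos, smul_eq_mul, mul_comm]
        exact mul_le_mul_of_nonneg_right (hM ζ hζ) hpos
    _ = M * (1 - m) := by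
        rw [Real.circleAverage_fun_smul, Real.circleAverage_fun_sub hK.circleIntegrable'
          (circleIntegrable_const m 0 R), circleAverage_poissonKernel hw,
          Real.circleAverage_const, smul_eq_mul]
    _ = M * (2 * ‖w‖ / (R + ‖w‖)) := by
        rw [hm]
        field_simp
        ring

lemma poissonIntegral_of_harmonicOnNhd {f : ℂ → ℂ} (hf : HarmonicOnNhd f (closedBall 0 R))
    (hw : w ∈ ball 0 R) : poissonIntegral f R w = f w := by
  have hR : 0 < R := pos_of_mem_ball hw
  have hsph : sphere (0 : ℂ) |R| ⊆ closedBall 0 R := by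
    rw [abs_of_pos hR]
    exact sphere_subset_closedBall
  have hi : CircleIntegrable (poissonKernel 0 w • f) 0 R :=
    ((continuousOn_poissonKernel_sphere hw).smul (hf.continuousOn.mono hsph)).circleIntegrable'
  have hL (L : ℂ →L[ℝ] ℝ) : L (poissonIntegral f R w) = L (f w) := by
    rw [poissonIntegral, ← L.circleAverage_comp_comm hi]
    convert (hf.comp_CLM L).circleAverage_poissonKernel_smul hw using 2
    · ext ζ
      simp only [Function.comp_apply, Pi.smul_apply', map_smul]
    · rfl
  exact Complex.ext (hL Complex.reCLM) (hL Complex.imCLM)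

end Poisson

section GradientEstimate

lemma integral_abs_cos : ∫ θ in (0 : ℝ)..2 * π, |Real.cos θ| = 4 := by
  have hp : Function.Periodic (fun θ ↦ |Real.cos θ|) π := fun θ ↦ by simp
  have hi : ∀ a b, IntervalIntegrable (fun θ ↦ |Real.cos θ|) volume a b :=
    fun a b ↦ Real.continuous_cos.abs.intervalIntegrable a b
  have hhalf : ∫ θ in -(π / 2)..π / 2, |Real.cos θ| = 2 := by
    have habs : EqOn (fun θ ↦ |Real.cos θ|) Real.cos [[-(π / 2), π / 2]] := fun θ hθ ↦ by
      rw [uIcc_of_le (by linarith [Real.pi_pos])] at hθ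
      exact abs_of_nonneg (Real.cos_nonneg_of_mem_Icc hθ)
    rw [intervalIntegral.integral_congr habs, integral_cos, Real.sin_neg, Real.sin_pi_div_two]
    norm_num
  calc ∫ θ in (0 : ℝ)..2 * π, |Real.cos θ|
      = (2 : ℤ) • ∫ θ in (0 : ℝ)..π, |Real.cos θ| := by
        simpa using hp.intervalIntegral_add_zsmul_eq 2 0 hi
    _ = (2 : ℤ) • ∫ θ in -(π / 2)..π / 2, |Real.cos θ| := by
        have hshift := hp.intervalIntegral_add_eq 0 (-(π / 2))
        rw [zero_add, show -(π / 2) + π = π / 2 by ring] at hshift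
        rw [hshift]
    _ = 4 := by rw [hhalf]; norm_num

lemma circleAverage_abs_re_div (e : ℂ) {R : ℝ} (hR : 0 < R) :
    Real.circleAverage (fun ζ ↦ |(e / ζ).re|) 0 R = 2 / π * (‖e‖ / R) := by
  have hrot : ∀ θ : ℝ, |(e / (Complex.exp (e.arg * Complex.I) * circleMap 0 R θ)).re| =
      ‖e‖ / R * |Real.cos θ| := fun θ ↦ by
    have hquot : e / (Complex.exp (e.arg * Complex.I) * circleMap 0 R θ) =
        (‖e‖ / R : ℝ) * Complex.exp ((-θ : ℝ) * Complex.I) := by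
      nth_rw 1 [← Complex.norm_mul_exp_arg_mul_I e]
      rw [circleMap_zero, Complex.ofReal_neg, neg_mul, Complex.exp_neg]
      have := Complex.exp_ne_zero (e.arg * Complex.I)
      push_cast
      field_simp
    rw [hquot, Complex.re_ofReal_mul, Complex.exp_ofReal_mul_I_re, Real.cos_neg, abs_mul,
      abs_of_nonneg (by positivity)]
  rw [← circleAverage_comp_mul_left _ (Complex.norm_exp_ofReal_mul_I e.arg), Real.circleAverage]
  simp only [hrot, intervalIntegral.integral_const_mul, integral_abs_cos, smul_eq_mul]
  field_simp
  ring

variable {f g : ℂ → ℂ} {M R : ℝ}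

lemma fderiv_poissonIntegral_zero (hg : CircleIntegrable g 0 R) (hR : 0 < R) (e : ℂ) :
    fderiv ℝ (poissonIntegral g R) 0 e =
      Real.circleAverage (fun ζ ↦ (2 * (e / ζ).re) • g ζ) 0 R := by
  have hbar : CircleIntegrable (fun ζ ↦ g ζ / conj ζ) 0 R := by
    simpa using circleIntegrable_conj (circleIntegrable_div_self (circleIntegrable_conj hg) hR.ne')
  rw [fderiv_apply_eq_wirtinger, wirtinger_poissonIntegral_zero hg hR,
    wirtingerBar_poissonIntegral_zero hg hR, mul_comm, ← smul_eq_mul,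
    ← Real.circleAverage_fun_smul, mul_comm, ← smul_eq_mul, ← Real.circleAverage_fun_smul,
    ← Real.circleAverage_fun_add ((circleIntegrable_div_self hg hR.ne').const_fun_smul)
      hbar.const_fun_smul]
  congr 1 with ζ
  simp only [Complex.real_smul, Complex.ofReal_mul, Complex.re_eq_add_conj, smul_eq_mul, map_div₀,
    Complex.ofReal_ofNat]
  ring

lemma norm_fderiv_poissonIntegral_zero_le (hg : CircleIntegrable g 0 R) (hR : 0 < R)
    (hM : ∀ ζ ∈ sphere 0 |R|, ‖g ζ‖ ≤ M) :
    ‖fderiv ℝ (poissonIntegral g R) 0‖ ≤ 4 / π * (M / R) := by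
  have hM0 : 0 ≤ M := (norm_nonneg _).trans (hM R (by simp))
  refine ContinuousLinearMap.opNorm_le_bound _ (by positivity) fun e ↦ ?_
  have hint : CircleIntegrable (fun ζ ↦ |(e / ζ).re|) 0 R := by
    refine ContinuousOn.circleIntegrable' (.abs ?_)
    refine Complex.continuous_re.comp_continuousOn (.div continuousOn_const continuousOn_id ?_)
    exact fun ζ hζ ↦ ne_zero_of_mem_sphere (abs_pos.2 hR.ne').ne' ⟨ζ, hζ⟩
  calc ‖fderiv ℝ (poissonIntegral g R) 0 e‖
      ≤ Real.circleAverage (fun ζ ↦ (2 * M) • |(e / ζ).re|) 0 R := by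
        rw [fderiv_poissonIntegral_zero hg hR]
        refine norm_circleAverage_le_circleAverage hint.const_fun_smul fun ζ hζ ↦ ?_
        rw [norm_smul, Real.norm_eq_abs, abs_mul, abs_two, smul_eq_mul, mul_right_comm]
        gcongr
        exact hM ζ hζ
    _ = 4 / π * (M / R) * ‖e‖ := by
        rw [Real.circleAverage_fun_smul, circleAverage_abs_re_div e hR, smul_eq_mul]
        ring

lemma norm_fderiv_zero_le_of_harmonicOnNhd_closedBall (hf : HarmonicOnNhd f (closedBall 0 R))
    (hR : 0 < R) (hM : ∀ ζ ∈ sphere 0 R, ‖f ζ‖ ≤ M) :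
    ‖fderiv ℝ f 0‖ ≤ 4 / π * (M / R) := by
  rw [← abs_of_pos hR] at hM
  have hi : CircleIntegrable f 0 R :=
    (hf.continuousOn.mono sphere_subset_closedBall).circleIntegrable hR.le
  have heq : poissonIntegral f R =ᶠ[𝓝 0] f := by
    filter_upwards [ball_mem_nhds 0 hR] with w hw using poissonIntegral_of_harmonicOnNhd hf hw
  rw [← heq.fderiv_eq]
  exact norm_fderiv_poissonIntegral_zero_le hi hR hM

lemma norm_fderiv_zero_le_of_harmonicOnNhd_ball (hf : HarmonicOnNhd f (ball 0 R))
    (hR : 0 < R) (hM : ∀ z ∈ ball 0 R, ‖f z‖ ≤ M) : ‖fderiv ℝ f 0‖ ≤ 4 / π * (M / R) := by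
  have hlim : Tendsto (fun r ↦ 4 / π * (M / r)) (𝓝[<] R) (𝓝 (4 / π * (M / R))) :=
    ((tendsto_const_nhds.div tendsto_id hR.ne').const_mul _).mono_left nhdsWithin_le_nhds
  refine ge_of_tendsto hlim ?_
  filter_upwards [Ioo_mem_nhdsLT hR] with r ⟨hr0, hrR⟩
  have hsub : closedBall (0 : ℂ) r ⊆ ball 0 R := closedBall_subset_ball hrR
  exact norm_fderiv_zero_le_of_harmonicOnNhd_closedBall (hf.mono hsub) hr0 fun ζ hζ ↦
    hM ζ (hsub (sphere_subset_closedBall hζ))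

end GradientEstimate

section ParametricIntegral

lemma hasDerivAt_integral_of_continuousOn {E : Type*} [NormedAddCommGroup E] [NormedSpace ℝ E]
    {F F' : ℝ → ℝ → E} {U : Set ℝ} {a b k : ℝ} (hU : U ∈ 𝓝 k)
    (hF : ∀ x ∈ U, ContinuousOn (F x) [[a, b]])
    (hF' : ContinuousOn (Function.uncurry F') (U ×ˢ [[a, b]]))
    (hderiv : ∀ x ∈ U, ∀ θ ∈ [[a, b]], HasDerivAt (F · θ) (F' x θ) x) :
    HasDerivAt (fun x ↦ ∫ θ in a..b, F x θ) (∫ θ in a..b, F' k θ) k := by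
  obtain ⟨K, hKk, hKU, hK⟩ := local_compact_nhds hU
  obtain ⟨C, hC⟩ := (hK.prod isCompact_uIcc).exists_bound_of_continuousOn
    (hF'.mono (prod_mono hKU subset_rfl))
  have hkU : k ∈ U := mem_of_mem_nhds hU
  have hF'k : ContinuousOn (F' k) [[a, b]] :=
    hF'.comp (by fun_prop) fun θ hθ ↦ (⟨hkU, hθ⟩ : (k, θ) ∈ U ×ˢ [[a, b]])
  refine (intervalIntegral.hasDerivAt_integral_of_dominated_loc_of_deriv_le
    (bound := fun _ ↦ C) hKk ?_ (hF k hkU).intervalIntegrable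
    hF'k.intervalIntegrable.def'.aestronglyMeasurable ?_ intervalIntegrable_const ?_).2
  · filter_upwards [hU] with x hx using (hF x hx).intervalIntegrable.def'.aestronglyMeasurable
  · exact .of_forall fun θ hθ x hx ↦ hC (x, θ) ⟨hx, uIoc_subset_uIcc hθ⟩
  · exact .of_forall fun θ hθ x hx ↦ hderiv x (hKU hx) θ (uIoc_subset_uIcc hθ)

end ParametricIntegral

section EllipseRadius

/-- The modulus of the point `cos θ + i k sin θ` of the ellipse with half-axes `1` and `|k|`. -/
noncomputable def ellipseRadius (k θ : ℝ) : ℝ := √(Real.cos θ ^ 2 + k ^ 2 * Real.sin θ ^ 2)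

lemma ellipseRadius_nonneg (k θ : ℝ) : 0 ≤ ellipseRadius k θ := Real.sqrt_nonneg _

lemma ellipseRadius_sq (k θ : ℝ) :
    ellipseRadius k θ ^ 2 = Real.cos θ ^ 2 + k ^ 2 * Real.sin θ ^ 2 :=
  Real.sq_sqrt (by positivity)

lemma ellipseRadius_neg (k θ : ℝ) : ellipseRadius (-k) θ = ellipseRadius k θ := by
  simp [ellipseRadius]

lemma ellipseRadius_one (θ : ℝ) : ellipseRadius 1 θ = 1 := by
  simp [ellipseRadius]

lemma ellipseRadius_zero (θ : ℝ) : ellipseRadius 0 θ = |Real.cos θ| := by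
  simp [ellipseRadius, Real.sqrt_sq_eq_abs]

lemma abs_cos_le_ellipseRadius (k θ : ℝ) : |Real.cos θ| ≤ ellipseRadius k θ :=
  Real.abs_le_sqrt (le_add_of_nonneg_right (by positivity))

lemma abs_mul_sin_le_ellipseRadius (k θ : ℝ) : |k * Real.sin θ| ≤ ellipseRadius k θ := by
  refine Real.abs_le_sqrt ?_
  rw [mul_pow]
  exact le_add_of_nonneg_left (by positivity)

lemma cos_sq_le_ellipseRadius (k θ : ℝ) : |Real.cos θ ^ 2| ≤ ellipseRadius k θ := by
  rw [abs_pow]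
  exact (pow_le_of_le_one (abs_nonneg _) (Real.abs_cos_le_one θ) two_ne_zero).trans
    (abs_cos_le_ellipseRadius k θ)

lemma abs_mul_sin_sq_le_ellipseRadius (k θ : ℝ) :
    |k * Real.sin θ ^ 2| ≤ ellipseRadius k θ := by
  rw [pow_two, ← mul_assoc, abs_mul]
  exact (mul_le_of_le_one_right (abs_nonneg _) (Real.abs_sin_le_one θ)).trans
    (abs_mul_sin_le_ellipseRadius k θ)

lemma abs_sin_mul_cos_le_ellipseRadius (k θ : ℝ) :
    |Real.sin θ * Real.cos θ| ≤ ellipseRadius k θ := by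
  rw [abs_mul]
  exact (mul_le_of_le_one_left (abs_nonneg _) (Real.abs_sin_le_one θ)).trans
    (abs_cos_le_ellipseRadius k θ)

lemma ellipseRadius_pos_of_cos_ne_zero (k : ℝ) {θ : ℝ} (h : Real.cos θ ≠ 0) :
    0 < ellipseRadius k θ :=
  (abs_pos.2 h).trans_le (abs_cos_le_ellipseRadius k θ)

lemma ellipseRadius_pos {k : ℝ} (hk : k ≠ 0) (θ : ℝ) : 0 < ellipseRadius k θ := by
  by_cases hcos : Real.cos θ = 0
  · have hsin : Real.sin θ ≠ 0 := fun h ↦ by simpa [hcos, h] using Real.sin_sq_add_cos_sq θ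
    exact (abs_pos.2 (mul_ne_zero hk hsin)).trans_le (abs_mul_sin_le_ellipseRadius k θ)
  · exact ellipseRadius_pos_of_cos_ne_zero k hcos

lemma continuous_uncurry_ellipseRadius : Continuous (Function.uncurry ellipseRadius) := by
  unfold Function.uncurry ellipseRadius
  fun_prop

lemma continuous_ellipseRadius (k : ℝ) : Continuous (ellipseRadius k) :=
  continuous_uncurry_ellipseRadius.uncurry_left k

lemma continuousOn_div_ellipseRadius_pow {u : ℝ → ℝ → ℝ} (hu : Continuous (Function.uncurry u))
    (n : ℕ) (s : Set ℝ) :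
    ContinuousOn (Function.uncurry fun k θ ↦ u k θ / ellipseRadius k θ ^ n) ({0}ᶜ ×ˢ s) :=
  hu.continuousOn.div (continuous_uncurry_ellipseRadius.pow n).continuousOn fun p hp ↦
    pow_ne_zero n (ellipseRadius_pos hp.1 p.2).ne'

lemma hasDerivAt_ellipseRadius_left {k : ℝ} (hk : k ≠ 0) (θ : ℝ) :
    HasDerivAt (ellipseRadius · θ) (k * Real.sin θ ^ 2 / ellipseRadius k θ) k := by
  have hρ := ellipseRadius_pos hk θ
  have hsq : HasDerivAt (fun k : ℝ ↦ Real.cos θ ^ 2 + k ^ 2 * Real.sin θ ^ 2)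
      (2 * k * Real.sin θ ^ 2) k := by
    simpa using ((hasDerivAt_pow 2 k).mul_const (Real.sin θ ^ 2)).const_add (Real.cos θ ^ 2)
  refine (hsq.sqrt (ellipseRadius_sq k θ ▸ (pow_pos hρ 2).ne')).congr_deriv ?_
  rw [← ellipseRadius]
  field_simp

lemma hasDerivAt_ellipseRadius_right {k : ℝ} (hk : k ≠ 0) (θ : ℝ) :
    HasDerivAt (ellipseRadius k)
      ((k ^ 2 - 1) * (Real.sin θ * Real.cos θ) / ellipseRadius k θ) θ := by
  have hρ := ellipseRadius_pos hk θ
  have hsq : HasDerivAt (fun θ : ℝ ↦ Real.cos θ ^ 2 + k ^ 2 * Real.sin θ ^ 2)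
      (2 * ((k ^ 2 - 1) * (Real.sin θ * Real.cos θ))) θ := by
    refine (((Real.hasDerivAt_cos θ).pow 2).add
      (((Real.hasDerivAt_sin θ).pow 2).const_mul (k ^ 2))).congr_deriv ?_
    push_cast
    ring
  refine (hsq.sqrt (ellipseRadius_sq k θ ▸ (pow_pos hρ 2).ne')).congr_deriv ?_
  rw [← ellipseRadius]
  field_simp

lemma norm_div_ellipseRadius_le_one {k θ x : ℝ} (h : |x| ≤ ellipseRadius k θ) :
    ‖x / ellipseRadius k θ‖ ≤ 1 := by
  rw [norm_div, Real.norm_of_nonneg (ellipseRadius_nonneg k θ)]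
  exact div_le_one_of_le₀ h (ellipseRadius_nonneg k θ)

lemma intervalIntegrable_div_ellipseRadius {u : ℝ → ℝ} {k : ℝ} (hu : Measurable u)
    (h : ∀ θ, |u θ| ≤ ellipseRadius k θ) (a b : ℝ) :
    IntervalIntegrable (fun θ ↦ u θ / ellipseRadius k θ) volume a b :=
  IntervalIntegrable.mono_fun' (g := fun _ ↦ 1) intervalIntegrable_const
    (hu.div (continuous_ellipseRadius k).measurable).aestronglyMeasurable
    (.of_forall fun θ ↦ norm_div_ellipseRadius_le_one (h θ))

lemma ae_cos_ne_zero : ∀ᵐ θ : ℝ, Real.cos θ ≠ 0 := by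
  have hcount : {θ : ℝ | Real.cos θ = 0}.Countable := by
    refine (countable_range fun n : ℤ ↦ (2 * n + 1) * π / 2).mono fun θ hθ ↦ ?_
    obtain ⟨n, hn⟩ := Real.cos_eq_zero_iff.1 hθ
    exact ⟨n, hn.symm⟩
  filter_upwards [hcount.ae_notMem volume] with θ hθ using hθ

lemma continuous_integral_div_ellipseRadius {u : ℝ → ℝ → ℝ}
    (hu : Continuous (Function.uncurry u)) (h : ∀ k θ, |u k θ| ≤ ellipseRadius k θ) (a b : ℝ) :
    Continuous fun k ↦ ∫ θ in a..b, u k θ / ellipseRadius k θ := by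
  refine intervalIntegral.continuous_of_dominated_interval (bound := fun _ ↦ 1) (fun k ↦ ?_)
    (fun k ↦ .of_forall fun θ _ ↦ norm_div_ellipseRadius_le_one (h k θ))
    intervalIntegrable_const ?_
  · exact ((hu.uncurry_left k).measurable.div
      (continuous_ellipseRadius k).measurable).aestronglyMeasurable
  · filter_upwards [ae_cos_ne_zero] with θ hθ _
    exact (hu.uncurry_right θ).div (continuous_uncurry_ellipseRadius.uncurry_right θ)
      fun k ↦ (ellipseRadius_pos_of_cos_ne_zero k hθ).ne'

end EllipseRadius

section EllipseCoefficients

/-- The coefficient of `cos θ` in the Fourier series of the real part of the normalized ellipse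
parametrization `θ ↦ (cos θ + i k sin θ) / |cos θ + i k sin θ|`. -/
noncomputable def ellipseCos (k : ℝ) : ℝ :=
  π⁻¹ * ∫ θ in (0 : ℝ)..2 * π, Real.cos θ ^ 2 / ellipseRadius k θ

/-- The coefficient of `sin θ` in the Fourier series of the imaginary part of the normalized
ellipse parametrization `θ ↦ (cos θ + i k sin θ) / |cos θ + i k sin θ|`. -/
noncomputable def ellipseSin (k : ℝ) : ℝ :=
  π⁻¹ * ∫ θ in (0 : ℝ)..2 * π, k * Real.sin θ ^ 2 / ellipseRadius k θ

/-- The derivative of `ellipseSin` at `k ≠ 0`, which also determines that of `ellipseCos`. -/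
noncomputable def ellipseSlope (k : ℝ) : ℝ :=
  π⁻¹ * ∫ θ in (0 : ℝ)..2 * π, Real.sin θ ^ 2 * Real.cos θ ^ 2 / ellipseRadius k θ ^ 3

lemma continuous_ellipseCos : Continuous ellipseCos :=
  continuous_const.mul <| continuous_integral_div_ellipseRadius
    (u := fun _ θ ↦ Real.cos θ ^ 2) (by unfold Function.uncurry; fun_prop)
    cos_sq_le_ellipseRadius 0 (2 * π)

lemma continuous_ellipseSin : Continuous ellipseSin :=
  continuous_const.mul <| continuous_integral_div_ellipseRadius
    (u := fun k θ ↦ k * Real.sin θ ^ 2) (by unfold Function.uncurry; fun_prop)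
    abs_mul_sin_sq_le_ellipseRadius 0 (2 * π)

lemma hasDerivAt_integral_div_ellipseRadius {k a b : ℝ} (hk : k ≠ 0) {u v : ℝ → ℝ → ℝ}
    (hu : Continuous (Function.uncurry u)) (hv : Continuous (Function.uncurry v))
    (h : ∀ k ≠ 0, ∀ θ, HasDerivAt (fun k ↦ u k θ / ellipseRadius k θ)
      (v k θ / ellipseRadius k θ ^ 3) k) :
    HasDerivAt (fun k ↦ ∫ θ in a..b, u k θ / ellipseRadius k θ)
      (∫ θ in a..b, v k θ / ellipseRadius k θ ^ 3) k :=
  hasDerivAt_integral_of_continuousOn (isOpen_compl_singleton.mem_nhds hk)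
    (fun x hx ↦ ((hu.uncurry_left x).div (continuous_ellipseRadius x)
      fun θ ↦ (ellipseRadius_pos hx θ).ne').continuousOn)
    (continuousOn_div_ellipseRadius_pow hv 3 _) fun x hx θ _ ↦ h x hx θ

lemma hasDerivAt_ellipseCos {k : ℝ} (hk : k ≠ 0) :
    HasDerivAt ellipseCos (-(k * ellipseSlope k)) k := by
  have hint := hasDerivAt_integral_div_ellipseRadius (a := 0) (b := 2 * π) hk
    (u := fun _ θ ↦ Real.cos θ ^ 2) (v := fun k θ ↦ -k * (Real.sin θ ^ 2 * Real.cos θ ^ 2))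
    (by unfold Function.uncurry; fun_prop) (by unfold Function.uncurry; fun_prop)
    fun k hk θ ↦ by
      have hρ := (ellipseRadius_pos hk θ).ne'
      refine ((hasDerivAt_const k (Real.cos θ ^ 2)).div
        (hasDerivAt_ellipseRadius_left hk θ) hρ).congr_deriv ?_
      field_simp
      ring
  refine (hint.const_mul π⁻¹).congr_deriv ?_
  simp only [ellipseSlope, mul_div_assoc, intervalIntegral.integral_const_mul]
  ring

lemma hasDerivAt_ellipseSin {k : ℝ} (hk : k ≠ 0) : HasDerivAt ellipseSin (ellipseSlope k) k := by
  refine (hasDerivAt_integral_div_ellipseRadius hk (u := fun k θ ↦ k * Real.sin θ ^ 2)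
    (v := fun _ θ ↦ Real.sin θ ^ 2 * Real.cos θ ^ 2) (by unfold Function.uncurry; fun_prop)
    (by unfold Function.uncurry; fun_prop) fun k hk θ ↦ ?_).const_mul π⁻¹
  have hρ := (ellipseRadius_pos hk θ).ne'
  refine (((hasDerivAt_id' k).mul_const (Real.sin θ ^ 2)).div
    (hasDerivAt_ellipseRadius_left hk θ) hρ).congr_deriv ?_
  have hsq := ellipseRadius_sq k θ
  field_simp
  rw [hsq]
  ring

lemma hasDerivAt_sin_mul_cos_div_ellipseRadius {k : ℝ} (hk : k ≠ 0) (θ : ℝ) :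
    HasDerivAt (fun θ ↦ Real.sin θ * Real.cos θ / ellipseRadius k θ)
      (Real.cos θ ^ 2 / ellipseRadius k θ - k⁻¹ * (k * Real.sin θ ^ 2 / ellipseRadius k θ)
        + (1 - k ^ 2) * (Real.sin θ ^ 2 * Real.cos θ ^ 2 / ellipseRadius k θ ^ 3)) θ := by
  have hρ := (ellipseRadius_pos hk θ).ne'
  refine (((Real.hasDerivAt_sin θ).mul (Real.hasDerivAt_cos θ)).div
    (hasDerivAt_ellipseRadius_right hk θ) hρ).congr_deriv ?_
  simp only [Pi.mul_apply]
  field_simp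
  ring

lemma one_sub_sq_mul_ellipseSlope {k : ℝ} (hk : k ≠ 0) :
    (1 - k ^ 2) * ellipseSlope k = ellipseSin k / k - ellipseCos k := by
  have hcos := intervalIntegrable_div_ellipseRadius (by fun_prop) (cos_sq_le_ellipseRadius k)
    0 (2 * π)
  have hsin := (intervalIntegrable_div_ellipseRadius (by fun_prop)
    (abs_mul_sin_sq_le_ellipseRadius k) 0 (2 * π)).const_mul k⁻¹
  have hslope : IntervalIntegrable (fun θ ↦ (1 - k ^ 2) *
      (Real.sin θ ^ 2 * Real.cos θ ^ 2 / ellipseRadius k θ ^ 3)) volume 0 (2 * π) :=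
    (Continuous.intervalIntegrable ((by fun_prop : Continuous fun θ : ℝ ↦
      Real.sin θ ^ 2 * Real.cos θ ^ 2).div ((continuous_ellipseRadius k).pow 3)
        fun θ ↦ pow_ne_zero 3 (ellipseRadius_pos hk θ).ne') _ _).const_mul _
  have hparts := intervalIntegral.integral_eq_sub_of_hasDerivAt
    (fun θ _ ↦ hasDerivAt_sin_mul_cos_div_ellipseRadius hk θ) ((hcos.sub hsin).add hslope)
  rw [intervalIntegral.integral_add (hcos.sub hsin) hslope,
    intervalIntegral.integral_sub hcos hsin, intervalIntegral.integral_const_mul,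
    intervalIntegral.integral_const_mul, Real.sin_two_pi, Real.sin_zero] at hparts
  rw [ellipseSlope, ellipseSin, ellipseCos, div_eq_mul_inv]
  linear_combination π⁻¹ * hparts

lemma ellipseCos_neg (k : ℝ) : ellipseCos (-k) = ellipseCos k := by
  simp [ellipseCos, ellipseRadius_neg]

lemma ellipseSin_neg (k : ℝ) : ellipseSin (-k) = -ellipseSin k := by
  simp [ellipseSin, ellipseRadius_neg, neg_div]

lemma ellipseSin_zero : ellipseSin 0 = 0 := by simp [ellipseSin]

lemma ellipseCos_one : ellipseCos 1 = 1 := by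
  simp [ellipseCos, ellipseRadius_one, Real.pi_ne_zero]

lemma ellipseSin_one : ellipseSin 1 = 1 := by
  simp [ellipseSin, ellipseRadius_one, Real.pi_ne_zero]

lemma ellipseCos_zero : ellipseCos 0 = 4 / π := by
  have hcos : ∀ θ, Real.cos θ ^ 2 / ellipseRadius 0 θ = |Real.cos θ| := fun θ ↦ by
    rw [ellipseRadius_zero, ← sq_abs, pow_two, mul_self_div_self]
  simp only [ellipseCos, hcos, integral_abs_cos]
  ring

lemma ellipseCos_pos (k : ℝ) : 0 < ellipseCos k := by
  rcases eq_or_ne k 0 with rfl | hk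
  · rw [ellipseCos_zero]
    positivity
  · refine mul_pos (by positivity) (intervalIntegral.integral_pos (by positivity) ?_ ?_ ?_)
    · exact ((Real.continuous_cos.pow 2).div (continuous_ellipseRadius k)
        fun θ ↦ (ellipseRadius_pos hk θ).ne').continuousOn
    · exact fun θ _ ↦ div_nonneg (sq_nonneg _) (ellipseRadius_nonneg k θ)
    · exact ⟨0, by simp [Real.pi_nonneg], by simpa using ellipseRadius_pos hk 0⟩

lemma ellipseSin_nonneg {k : ℝ} (hk : 0 ≤ k) : 0 ≤ ellipseSin k := by
  refine mul_nonneg (by positivity) (intervalIntegral.integral_nonneg (by positivity) fun θ _ ↦ ?_)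
  have := ellipseRadius_nonneg k θ
  positivity

lemma ellipseSlope_nonneg (k : ℝ) : 0 ≤ ellipseSlope k := by
  refine mul_nonneg (by positivity) (intervalIntegral.integral_nonneg (by positivity) fun θ _ ↦ ?_)
  have := ellipseRadius_nonneg k θ
  positivity

end EllipseCoefficients

section Comparison

lemma nonneg_of_hasDerivAt_nonpos_of_neg {w w' : ℝ → ℝ} {a b : ℝ}
    (hc : ContinuousOn w (Icc a b)) (hb : 0 ≤ w b)
    (hd : ∀ x ∈ Ioo a b, HasDerivAt w (w' x) x) (hw : ∀ x ∈ Ioo a b, w x < 0 → w' x ≤ 0)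
    {x : ℝ} (hx : x ∈ Icc a b) : 0 ≤ w x := by
  by_contra! hneg
  have hcx : ContinuousOn w (Icc x b) := hc.mono (Icc_subset_Icc_left hx.1)
  set S := Icc x b ∩ w ⁻¹' Ici 0
  have hSbdd : BddBelow S := ⟨x, fun y hy ↦ hy.1.1⟩
  obtain ⟨⟨hxm, hmb⟩, hm⟩ : sInf S ∈ S :=
    (hcx.preimage_isClosed_of_isClosed isClosed_Icc isClosed_Ici).csInf_mem
      ⟨b, right_mem_Icc.2 hx.2, hb⟩ hSbdd
  set m := sInf S
  have hlt : ∀ y ∈ Ioo x m, w y < 0 := fun y hy ↦ by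
    by_contra! h
    exact (csInf_le hSbdd ⟨⟨hy.1.le, hy.2.le.trans hmb⟩, h⟩).not_gt hy.2
  have hsub : Ioo x m ⊆ Ioo a b := Ioo_subset_Ioo hx.1 hmb
  have hanti : AntitoneOn w (Icc x m) := by
    refine antitoneOn_of_hasDerivWithinAt_nonpos (f' := w') (convex_Icc x m)
      (hcx.mono (Icc_subset_Icc_right hmb)) ?_ ?_ <;> rw [interior_Icc]
    · exact fun y hy ↦ (hd y (hsub hy)).hasDerivWithinAt
    · exact fun y hy ↦ hw y (hsub hy) (hlt y hy)
  exact ((hanti (left_mem_Icc.2 hxm) (right_mem_Icc.2 hxm) hxm).trans_lt hneg).not_ge hm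

/-- Eight times the quartic `a ^ 4 + 4 * (a * b) ^ 2 + b ^ 4` in the variables `p = a + b` and
`q = a - b`, see `coeffQuartic_add_sub`. -/
def coeffQuartic (p q : ℝ) : ℝ := 3 * p ^ 4 + 2 * p ^ 2 * q ^ 2 + 3 * q ^ 4

lemma coeffQuartic_add_sub (a b : ℝ) :
    coeffQuartic (a + b) (a - b) = 8 * (a ^ 4 + 4 * (a * b) ^ 2 + b ^ 4) := by
  rw [coeffQuartic]
  ring

lemma coeffQuartic_mul_mul (s p q : ℝ) :
    coeffQuartic (s * p) (s * q) = s ^ 4 * coeffQuartic p q := by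
  rw [coeffQuartic, coeffQuartic]
  ring

/-- The quotient `∂_q N / ∂_p N` of the partial derivatives of `N = coeffQuartic`, as a function
of `r = q / p`. -/
noncomputable def quarticGradRatio (r : ℝ) : ℝ := r * (1 + 3 * r ^ 2) / (3 + r ^ 2)

lemma hasDerivAt_quarticGradRatio (r : ℝ) :
    HasDerivAt quarticGradRatio ((3 + 26 * r ^ 2 + 3 * r ^ 4) / (3 + r ^ 2) ^ 2) r := by
  have hden : 3 + r ^ 2 ≠ 0 := by positivity
  refine (((hasDerivAt_id' r).mul (((hasDerivAt_pow 2 r).const_mul 3).const_add 1)).div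
    ((hasDerivAt_pow 2 r).const_add 3) hden).congr_deriv ?_
  simp only [Pi.mul_apply]
  push_cast
  ring

/- Along a solution `r` of the Riccati equation, the left-hand side is the derivative of
`quarticGradRatio r`. Both terms of the Riccati right-hand side are estimated by inserting
`quarticGradRatio r` for `k`. -/
lemma deriv_quarticGradRatio_mul_riccati_le_one {k r : ℝ} (hk0 : 0 < k) (hk1 : k < 1)
    (hr : 0 ≤ r) (h : quarticGradRatio r < k) :
    (3 + 26 * r ^ 2 + 3 * r ^ 4) / (3 + r ^ 2) ^ 2 * (r / k - (1 - r ^ 2) / (1 - k ^ 2)) ≤ 1 := by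
  have hk2 : 0 < 1 - k ^ 2 := by nlinarith
  rw [quarticGradRatio, div_lt_iff₀ (by positivity)] at h
  have hfirst : r / k ≤ (3 + r ^ 2) / (1 + 3 * r ^ 2) := by
    rw [div_le_div_iff₀ hk0 (by positivity)]
    linarith
  have hsecond : (3 + r ^ 2) ^ 2 / (9 + 14 * r ^ 2 + 9 * r ^ 4) ≤ (1 - r ^ 2) / (1 - k ^ 2) := by
    rw [div_le_div_iff₀ (by positivity) hk2]
    have hsq : (r * (1 + 3 * r ^ 2)) ^ 2 ≤ (k * (3 + r ^ 2)) ^ 2 := by gcongr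
    linarith
  calc _ ≤ (3 + 26 * r ^ 2 + 3 * r ^ 4) / (3 + r ^ 2) ^ 2 *
        ((3 + r ^ 2) / (1 + 3 * r ^ 2) - (3 + r ^ 2) ^ 2 / (9 + 14 * r ^ 2 + 9 * r ^ 4)) := by
        gcongr
    _ = 1 - 9 * (1 - r ^ 2) ^ 4 /
        ((3 + r ^ 2) * (1 + 3 * r ^ 2) * (9 + 14 * r ^ 2 + 9 * r ^ 4)) := by
        field_simp
        ring
    _ ≤ 1 := sub_le_self _ (by positivity)

lemma hasDerivAt_ellipseSin_div_ellipseCos {k : ℝ} (hk0 : k ≠ 0) (hk2 : 1 - k ^ 2 ≠ 0) :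
    HasDerivAt (fun k ↦ ellipseSin k / ellipseCos k)
      (ellipseSin k / ellipseCos k / k
        - (1 - (ellipseSin k / ellipseCos k) ^ 2) / (1 - k ^ 2)) k := by
  have hcos := (ellipseCos_pos k).ne'
  refine ((hasDerivAt_ellipseSin hk0).div (hasDerivAt_ellipseCos hk0) hcos).congr_deriv ?_
  rw [eq_div_of_mul_eq hk2 ((mul_comm _ _).trans (one_sub_sq_mul_ellipseSlope hk0))]
  field_simp
  ring

lemma le_quarticGradRatio_ellipse {k : ℝ} (hk : k ∈ Icc (0 : ℝ) 1) :
    k ≤ quarticGradRatio (ellipseSin k / ellipseCos k) := by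
  have hd : ∀ x ∈ Ioo (0 : ℝ) 1, HasDerivAt
      (fun x ↦ quarticGradRatio (ellipseSin x / ellipseCos x) - x) _ x := fun x hx ↦
    ((hasDerivAt_quarticGradRatio _).comp x (hasDerivAt_ellipseSin_div_ellipseCos hx.1.ne'
      (by nlinarith [hx.1, hx.2]))).sub (hasDerivAt_id' x)
  have hcont : Continuous fun x ↦ quarticGradRatio (ellipseSin x / ellipseCos x) - x := by
    have hr := continuous_ellipseSin.div continuous_ellipseCos fun k ↦ (ellipseCos_pos k).ne'
    have hq : Continuous quarticGradRatio :=
      continuous_iff_continuousAt.2 fun r ↦ (hasDerivAt_quarticGradRatio r).continuousAt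
    exact (hq.comp hr).sub continuous_id
  refine sub_nonneg.1 (nonneg_of_hasDerivAt_nonpos_of_neg hcont.continuousOn ?_ hd ?_ hk)
  · norm_num [quarticGradRatio, ellipseCos_one, ellipseSin_one]
  · exact fun x hx hneg ↦ sub_nonpos.2 <| deriv_quarticGradRatio_mul_riccati_le_one hx.1 hx.2
      (div_nonneg (ellipseSin_nonneg hx.1.le) (ellipseCos_pos x).le) (sub_neg.1 hneg)

lemma hasDerivAt_coeffQuartic_ellipse {k : ℝ} (hk : k ≠ 0) :
    HasDerivAt (fun k ↦ coeffQuartic (ellipseCos k) (ellipseSin k))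
      (4 * ellipseCos k ^ 3 * (3 + (ellipseSin k / ellipseCos k) ^ 2) * ellipseSlope k *
        (quarticGradRatio (ellipseSin k / ellipseCos k) - k)) k := by
  have hcos := (ellipseCos_pos k).ne'
  have hP := hasDerivAt_ellipseCos hk
  have hQ := hasDerivAt_ellipseSin hk
  refine ((((hP.pow 4).const_mul 3).add (((hP.pow 2).const_mul 2).mul (hQ.pow 2))).add
    ((hQ.pow 4).const_mul 3)).congr_deriv ?_
  simp only [Pi.pow_apply, quarticGradRatio]
  push_cast
  field_simp
  ring

lemma monotoneOn_coeffQuartic_ellipse :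
    MonotoneOn (fun k ↦ coeffQuartic (ellipseCos k) (ellipseSin k)) (Icc 0 1) := by
  have hcont : Continuous fun k ↦ coeffQuartic (ellipseCos k) (ellipseSin k) := by
    have := continuous_ellipseCos
    have := continuous_ellipseSin
    unfold coeffQuartic
    fun_prop
  refine monotoneOn_of_hasDerivWithinAt_nonneg (convex_Icc 0 1) hcont.continuousOn
    (fun k hk ↦ (hasDerivAt_coeffQuartic_ellipse ?_).hasDerivWithinAt) fun k hk ↦ ?_ <;>
  rw [interior_Icc] at hk
  · exact hk.1.ne'
  · have hcos := ellipseCos_pos k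
    have hslope := ellipseSlope_nonneg k
    have hgrad := sub_nonneg.2 (le_quarticGradRatio_ellipse (Ioo_subset_Icc_self hk))
    positivity

lemma le_coeffQuartic_ellipse {k : ℝ} (hk : k ∈ Icc (-1 : ℝ) 1) :
    8 * (96 / π ^ 4) ≤ coeffQuartic (ellipseCos k) (ellipseSin k) := by
  wlog hk0 : 0 ≤ k generalizing k
  · have hneg := this (k := -k) ⟨by linarith [hk.2], by linarith [hk.1]⟩ (by linarith)
    simpa [ellipseCos_neg, ellipseSin_neg, coeffQuartic, Even.neg_pow (by decide : Even 4)]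
      using hneg
  calc 8 * (96 / π ^ 4) = coeffQuartic (ellipseCos 0) (ellipseSin 0) := by
        rw [ellipseCos_zero, ellipseSin_zero, coeffQuartic]
        ring
    _ ≤ coeffQuartic (ellipseCos k) (ellipseSin k) :=
        monotoneOn_coeffQuartic_ellipse (left_mem_Icc.2 zero_le_one) ⟨hk0, hk.2⟩ hk0

lemma exists_ellipse_proportional {a b : ℝ} (ha : 0 ≤ a) (hb : 0 ≤ b) :
    ∃ k ∈ Icc (-1 : ℝ) 1, ∃ s, 0 ≤ s ∧ a + b = s * ellipseCos k ∧ a - b = s * ellipseSin k := by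
  have hcont : Continuous fun k ↦ (a - b) * ellipseCos k - (a + b) * ellipseSin k :=
    (continuous_ellipseCos.const_mul _).sub (continuous_ellipseSin.const_mul _)
  obtain ⟨k, hk, hroot⟩ : (0 : ℝ) ∈
      (fun k ↦ (a - b) * ellipseCos k - (a + b) * ellipseSin k) '' Icc (-1) 1 := by
    refine intermediate_value_Icc' (by norm_num) hcont.continuousOn ⟨?_, ?_⟩ <;>
    simp only [ellipseCos_neg, ellipseSin_neg, ellipseCos_one, ellipseSin_one] <;>
    linarith
  have hcos := ellipseCos_pos k
  refine ⟨k, hk, (a + b) / ellipseCos k, by positivity, by field_simp, ?_⟩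
  field_simp
  exact sub_eq_zero.1 hroot

lemma exists_ellipse_of_quartic_le {a b : ℝ} (ha : 0 ≤ a) (hb : 0 ≤ b)
    (h : a ^ 4 + 4 * (a * b) ^ 2 + b ^ 4 ≤ 96 / π ^ 4) :
    ∃ k s : ℝ, 0 ≤ s ∧ s ≤ 1 ∧ a + b = s * ellipseCos k ∧ a - b = s * ellipseSin k := by
  obtain ⟨k, hk, s, hs, hadd, hsub⟩ := exists_ellipse_proportional ha hb
  refine ⟨k, s, hs, (pow_le_one_iff_of_nonneg hs four_ne_zero).1 ?_, hadd, hsub⟩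
  have hpos : 0 < 8 * (96 / π ^ 4) := by positivity
  refine le_of_mul_le_mul_right ?_ (hpos.trans_le (le_coeffQuartic_ellipse hk))
  calc s ^ 4 * coeffQuartic (ellipseCos k) (ellipseSin k)
      = 8 * (a ^ 4 + 4 * (a * b) ^ 2 + b ^ 4) := by
        rw [← coeffQuartic_mul_mul, ← hadd, ← hsub, coeffQuartic_add_sub]
    _ ≤ 8 * (96 / π ^ 4) := by gcongr
    _ ≤ 1 * coeffQuartic (ellipseCos k) (ellipseSin k) := by
        rw [one_mul]
        exact le_coeffQuartic_ellipse hk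

end Comparison

section EllipseMap

/-- The normalized ellipse parametrization `exp (i θ) ↦ (cos θ + i k sin θ) / |cos θ + i k sin θ|`
on the unit circle, extended to the plane. Its multiples serve as boundary values of harmonic
self-maps of the disk. -/
noncomputable def ellipseMap (k : ℝ) (ζ : ℂ) : ℂ :=
  (ζ.re + k * ζ.im * Complex.I) / (√(ζ.re ^ 2 + k ^ 2 * ζ.im ^ 2) : ℝ)

lemma norm_ellipseMap_le_one (k : ℝ) (ζ : ℂ) : ‖ellipseMap k ζ‖ ≤ 1 := by
  rw [ellipseMap, norm_div, Complex.norm_real, Real.norm_of_nonneg (Real.sqrt_nonneg _),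
    ← Complex.ofReal_mul, Complex.norm_add_mul_I, mul_pow]
  exact div_self_le_one _

lemma measurable_ellipseMap (k : ℝ) : Measurable (ellipseMap k) := by
  unfold ellipseMap
  fun_prop

lemma ellipseMap_neg (k : ℝ) (ζ : ℂ) : ellipseMap k (-ζ) = -ellipseMap k ζ := by
  simp only [ellipseMap, Complex.neg_re, Complex.neg_im, Complex.ofReal_neg, neg_sq]
  ring

lemma ellipseMap_circleMap (k θ : ℝ) : ellipseMap k (circleMap 0 1 θ) =
    (Real.cos θ + k * Real.sin θ * Complex.I) / ellipseRadius k θ := by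
  simp [ellipseMap, ellipseRadius, circleMap, Complex.exp_ofReal_mul_I_re,
    Complex.exp_ofReal_mul_I_im]

lemma circleIntegrable_of_measurable_of_norm_le {E : Type*} [NormedAddCommGroup E]
    [MeasurableSpace E] [BorelSpace E] [SecondCountableTopology E] {f : ℂ → E} {M : ℝ}
    (hf : Measurable f) (hM : ∀ z, ‖f z‖ ≤ M) (c : ℂ) (R : ℝ) : CircleIntegrable f c R :=
  IntervalIntegrable.mono_fun' (g := fun _ ↦ M) intervalIntegrable_const
    (hf.comp (measurable_circleMap c R)).aestronglyMeasurable (.of_forall fun _ ↦ hM _)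

lemma integral_sin_mul_cos_div_ellipseRadius (k : ℝ) :
    ∫ θ in (0 : ℝ)..2 * π, Real.sin θ * Real.cos θ / ellipseRadius k θ = 0 := by
  have hreflect := intervalIntegral.integral_comp_sub_left (a := 0) (b := 2 * π)
    (fun θ ↦ Real.sin θ * Real.cos θ / ellipseRadius k θ) (2 * π)
  simp only [ellipseRadius, Real.sin_two_pi_sub, Real.cos_two_pi_sub, neg_sq, neg_mul, neg_div,
    sub_zero, sub_self, intervalIntegral.integral_neg] at hreflect
  exact self_eq_neg.1 hreflect.symm

lemma circleAverage_eq_ellipseCos_add_ellipseSin {f : ℂ → ℂ} {k σ τ : ℝ}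
    (h : ∀ θ, f (circleMap 0 1 θ) =
      ((Real.cos θ ^ 2 / ellipseRadius k θ + σ * (k * Real.sin θ ^ 2 / ellipseRadius k θ) : ℝ) : ℂ)
        + ((τ * (Real.sin θ * Real.cos θ / ellipseRadius k θ) : ℝ) : ℂ) * Complex.I) :
    Real.circleAverage f 0 1 = ((ellipseCos k + σ * ellipseSin k) / 2 : ℝ) := by
  have hcos := intervalIntegrable_div_ellipseRadius (by fun_prop) (cos_sq_le_ellipseRadius k)
    0 (2 * π)
  have hsin := (intervalIntegrable_div_ellipseRadius (by fun_prop)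
    (abs_mul_sin_sq_le_ellipseRadius k) 0 (2 * π)).const_mul σ
  have hmix := (intervalIntegrable_div_ellipseRadius (by fun_prop)
    (abs_sin_mul_cos_le_ellipseRadius k) 0 (2 * π)).const_mul τ
  have hofReal {v : ℝ → ℝ} (hv : IntervalIntegrable v volume 0 (2 * π)) :
      IntervalIntegrable (fun θ ↦ (v θ : ℂ)) volume 0 (2 * π) := ⟨hv.1.ofReal, hv.2.ofReal⟩
  rw [Real.circleAverage]
  simp only [h]
  rw [intervalIntegral.integral_add (hofReal (hcos.add hsin)) ((hofReal hmix).mul_const _),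
    intervalIntegral.integral_mul_const, intervalIntegral.integral_ofReal,
    intervalIntegral.integral_ofReal, intervalIntegral.integral_add hcos hsin,
    intervalIntegral.integral_const_mul, intervalIntegral.integral_const_mul,
    integral_sin_mul_cos_div_ellipseRadius, ellipseCos, ellipseSin, mul_zero, Complex.ofReal_zero,
    zero_mul, add_zero, Complex.real_smul, ← Complex.ofReal_mul]
  congr 1
  field_simp

lemma circleAverage_ellipseMap_div (k : ℝ) :
    Real.circleAverage (fun ζ ↦ ellipseMap k ζ / ζ) 0 1 =
      ((ellipseCos k + ellipseSin k) / 2 : ℝ) := by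
  rw [circleAverage_eq_ellipseCos_add_ellipseSin (k := k) (σ := 1) (τ := k - 1), one_mul]
  intro θ
  rw [ellipseMap_circleMap, circleMap_zero, Complex.ofReal_one, one_mul, div_eq_mul_inv _
    (Complex.exp _), ← Complex.exp_neg, ← neg_mul, Complex.exp_mul_I, Complex.cos_neg,
    Complex.sin_neg]
  push_cast
  linear_combination (-k * Complex.sin θ ^ 2 / (ellipseRadius k θ : ℂ)) * Complex.I_mul_I

lemma circleAverage_ellipseMap_div_conj (k : ℝ) :
    Real.circleAverage (fun ζ ↦ ellipseMap k ζ / conj ζ) 0 1 =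
      ((ellipseCos k - ellipseSin k) / 2 : ℝ) := by
  rw [circleAverage_eq_ellipseCos_add_ellipseSin (k := k) (σ := -1) (τ := k + 1), neg_one_mul,
    sub_eq_add_neg]
  intro θ
  rw [ellipseMap_circleMap, circleMap_zero, Complex.ofReal_one, one_mul, ← Complex.exp_conj,
    map_mul, Complex.conj_ofReal, Complex.conj_I, mul_neg, Complex.exp_neg, div_inv_eq_mul,
    Complex.exp_mul_I]
  push_cast
  linear_combination (k * Complex.sin θ ^ 2 / (ellipseRadius k θ : ℂ)) * Complex.I_mul_I

lemma circleAverage_mul_comp_mul_div (g : ℂ → ℂ) (c : ℂ) {u : ℂ} (hu : ‖u‖ = 1) (R : ℝ) :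
    Real.circleAverage (fun ζ ↦ c * g (u * ζ) / ζ) 0 R =
      c * u * Real.circleAverage (fun ζ ↦ g ζ / ζ) 0 R := by
  have hu0 : u ≠ 0 := norm_ne_zero_iff.1 (hu ▸ one_ne_zero)
  rw [← circleAverage_comp_mul_left (fun ζ ↦ g ζ / ζ) hu, ← smul_eq_mul,
    ← Real.circleAverage_fun_smul]
  congr 1 with ζ
  rw [smul_eq_mul, ← mul_div_mul_left _ ζ hu0]
  ring

lemma circleAverage_mul_comp_mul_div_conj (g : ℂ → ℂ) (c : ℂ) {u : ℂ} (hu : ‖u‖ = 1) (R : ℝ) :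
    Real.circleAverage (fun ζ ↦ c * g (u * ζ) / conj ζ) 0 R =
      c * conj u * Real.circleAverage (fun ζ ↦ g ζ / conj ζ) 0 R := by
  have hu0 : conj u ≠ 0 := by simpa using norm_ne_zero_iff.1 (hu ▸ one_ne_zero)
  rw [← circleAverage_comp_mul_left (fun ζ ↦ g ζ / conj ζ) hu, ← smul_eq_mul,
    ← Real.circleAverage_fun_smul]
  congr 1 with ζ
  rw [smul_eq_mul, map_mul, ← mul_div_mul_left _ (conj ζ) hu0]
  ring

lemma exists_harmonicOnNhd_of_ellipse (k : ℝ) {c u : ℂ} (hc : ‖c‖ ≤ 1) (hu : ‖u‖ = 1) :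
    ∃ f : ℂ → ℂ, HarmonicOnNhd f (ball 0 1) ∧ MapsTo f (ball 0 1) (ball 0 1) ∧ f 0 = 0 ∧
      wirtinger f 0 = c * u * ((ellipseCos k + ellipseSin k) / 2 : ℝ) ∧
      wirtingerBar f 0 = c * conj u * ((ellipseCos k - ellipseSin k) / 2 : ℝ) := by
  let g : ℂ → ℂ := fun ζ ↦ c * ellipseMap k (u * ζ)
  have hnorm : ∀ ζ, ‖g ζ‖ ≤ 1 := fun ζ ↦ by
    rw [norm_mul]
    exact mul_le_one₀ hc (norm_nonneg _) (norm_ellipseMap_le_one k _)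
  have hg : CircleIntegrable g 0 1 := circleIntegrable_of_measurable_of_norm_le
    (((measurable_ellipseMap k).comp (measurable_const_mul u)).const_mul c) hnorm 0 1
  have hmean : Real.circleAverage g 0 1 = 0 :=
    circleAverage_eq_zero_of_odd (fun ζ ↦ by simp only [g, mul_neg, ellipseMap_neg]) 1
  have hbound : ∀ w ∈ ball (0 : ℂ) 1, ‖poissonIntegral g 1 w‖ ≤ 1 * (2 * ‖w‖ / (1 + ‖w‖)) :=
    fun w hw ↦ norm_poissonIntegral_le hg (fun ζ _ ↦ hnorm ζ) hmean hw
  refine ⟨poissonIntegral g 1, harmonicOnNhd_poissonIntegral hg, fun w hw ↦ ?_, ?_, ?_, ?_⟩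
  · rw [mem_ball_zero_iff] at hw ⊢
    refine (hbound w (mem_ball_zero_iff.2 hw)).trans_lt ?_
    rw [one_mul, div_lt_one (by positivity)]
    linarith
  · simpa using hbound 0 (mem_ball_self one_pos)
  · rw [wirtinger_poissonIntegral_zero hg one_pos, circleAverage_mul_comp_mul_div _ c hu,
      circleAverage_ellipseMap_div]
  · rw [wirtingerBar_poissonIntegral_zero hg one_pos, circleAverage_mul_comp_mul_div_conj _ c hu,
      circleAverage_ellipseMap_div_conj]

end EllipseMap

section Coefficients

lemma exists_rotation (α β : ℂ) : ∃ v u : ℂ, ‖v‖ = 1 ∧ ‖u‖ = 1 ∧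
    α = ‖α‖ * (v * u) ∧ β = ‖β‖ * (v * conj u) := by
  refine ⟨Complex.exp (((α.arg + β.arg) / 2 : ℝ) * Complex.I),
    Complex.exp (((α.arg - β.arg) / 2 : ℝ) * Complex.I),
    Complex.norm_exp_ofReal_mul_I _, Complex.norm_exp_ofReal_mul_I _, ?_, ?_⟩
  · rw [← Complex.exp_add]
    convert (Complex.norm_mul_exp_arg_mul_I α).symm using 3
    push_cast
    ring
  · rw [← Complex.exp_conj, map_mul, Complex.conj_ofReal, Complex.conj_I, ← Complex.exp_add]
    convert (Complex.norm_mul_exp_arg_mul_I β).symm using 3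
    push_cast
    ring

lemma exists_harmonicOnNhd_of_quartic_le {α β : ℂ}
    (h : ‖α‖ ^ 4 + 4 * (‖α‖ * ‖β‖) ^ 2 + ‖β‖ ^ 4 ≤ 96 / π ^ 4) :
    ∃ f : ℂ → ℂ, HarmonicOnNhd f (ball 0 1) ∧ MapsTo f (ball 0 1) (ball 0 1) ∧
      f 0 = 0 ∧ wirtinger f 0 = α ∧ wirtingerBar f 0 = β := by
  obtain ⟨k, s, hs0, hs1, hadd, hsub⟩ :=
    exists_ellipse_of_quartic_le (norm_nonneg α) (norm_nonneg β) h
  obtain ⟨v, u, hv, hu, hα, hβ⟩ := exists_rotation α β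
  have hsv : ‖(s * v : ℂ)‖ ≤ 1 := by
    rwa [norm_mul, hv, mul_one, Complex.norm_real, Real.norm_of_nonneg hs0]
  obtain ⟨f, hf, hmaps, hzero, hwirt, hbar⟩ := exists_harmonicOnNhd_of_ellipse k hsv hu
  refine ⟨f, hf, hmaps, hzero, ?_, ?_⟩
  · have hnorm : ‖α‖ = s * ((ellipseCos k + ellipseSin k) / 2) := by
      linear_combination (hadd + hsub) / 2
    rw [hwirt, hα, hnorm]
    push_cast
    ring
  · have hnorm : ‖β‖ = s * ((ellipseCos k - ellipseSin k) / 2) := by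
      linear_combination (hadd - hsub) / 2
    rw [hbar, hβ, hnorm]
    push_cast
    ring

lemma le_two_div_pi_of_wirtinger_eq {f : ℂ → ℂ} {C : ℝ} (hf : HarmonicOnNhd f (ball 0 1))
    (hmaps : MapsTo f (ball 0 1) (ball 0 1)) (hwirt : wirtinger f 0 = C)
    (hbar : wirtingerBar f 0 = C) : C ≤ 2 / π := by
  have hgrad : ‖fderiv ℝ f 0‖ ≤ 4 / π * (1 / 1) := norm_fderiv_zero_le_of_harmonicOnNhd_ball hf
    one_pos fun z hz ↦ (mem_ball_zero_iff.1 (hmaps hz)).le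
  have hdir : fderiv ℝ f 0 1 = ((2 * C : ℝ) : ℂ) := by
    rw [fderiv_apply_eq_wirtinger, hwirt, hbar, map_one]
    push_cast
    ring
  have hle : 2 * C ≤ 2 * (2 / π) := calc
    2 * C ≤ ‖fderiv ℝ f 0 1‖ := by
      rw [hdir, Complex.norm_real]
      exact le_abs_self _
    _ ≤ ‖fderiv ℝ f 0‖ := by simpa using (fderiv ℝ f 0).le_opNorm 1
    _ ≤ 2 * (2 / π) := hgrad.trans_eq (by ring)
  linarith

end Coefficients

lemma rpow_one_fourth_le_iff {x c : ℝ} (hx : 0 ≤ x) (hc : 0 ≤ c) :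
    x ^ (1 / 4 : ℝ) ≤ c ↔ x ≤ c ^ 4 := by
  rw [one_div, Real.rpow_inv_le_iff_of_pos hx hc (by norm_num)]
  norm_cast

theorem theorem2 :
    (∀ α β : ℂ,
      ((‖α‖ ^ 4 + 4 * ‖α * β‖ ^ 2 + ‖β‖ ^ 4) / 6 : ℝ) ^ (1 / 4 : ℝ) ≤ 2 / Real.pi →
      ∃ f : ℂ → ℂ, HarmonicOnNhd f (ball 0 1) ∧ Set.MapsTo f (ball 0 1) (ball 0 1) ∧
        f 0 = 0 ∧ wirtinger f 0 = α ∧ wirtingerBar f 0 = β) ∧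
    (∀ C : ℝ, 2 / Real.pi < C → ∃ α β : ℂ,
      ((‖α‖ ^ 4 + 4 * ‖α * β‖ ^ 2 + ‖β‖ ^ 4) / 6 : ℝ) ^ (1 / 4 : ℝ) ≤ C ∧
      ¬ ∃ f : ℂ → ℂ, HarmonicOnNhd f (ball 0 1) ∧ Set.MapsTo f (ball 0 1) (ball 0 1) ∧
        f 0 = 0 ∧ wirtinger f 0 = α ∧ wirtingerBar f 0 = β) := by
  refine ⟨fun α β h ↦ exists_harmonicOnNhd_of_quartic_le ?_, fun C hC ↦ ⟨C, C, ?_, ?_⟩⟩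
  · rw [rpow_one_fourth_le_iff (by positivity) (by positivity), norm_mul] at h
    calc _ ≤ 6 * (2 / π) ^ 4 := by linarith
      _ = 96 / π ^ 4 := by ring
  · have hC0 : 0 ≤ C := le_trans (by positivity) hC.le
    rw [rpow_one_fourth_le_iff (by positivity) hC0, norm_mul, Complex.norm_real,
      Real.norm_of_nonneg hC0]
    exact le_of_eq (by ring)
  · rintro ⟨f, hf, hmaps, -, hwirt, hbar⟩
    exact hC.not_ge (le_two_div_pi_of_wirtinger_eq hf hmaps hwirt hbar)
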